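/- **Setting.** Let $\Gamma$ be a metric graph (a finite graph, loops and multiple edges allowed, each edge identified with an interval of finite positive length), $r\ge 0$ an integer, and $D$ a divisor on $\Gamma$. Write $T_v(\Gamma)$ for the set of outgoing tangent vectors at $v$ and $\mathrm{val}(v)=|T_v(\Gamma)|$. Let $\mathrm{PL}(\Gamma)$ be the set of continuous piecewise linear functions on $\Gamma$ with integer slopes, $\mathrm{sl}_\eta(f)$ the outgoing slope of $f$ along $\eta$, $\mathrm{ord}_v(f)=-\sum_{\eta\in T_v(\Gamma)}\mathrm{sl}_\eta(f)$, $\mathrm{div}(f)=\sum_v \mathrm{ord}_v(f)\cdot v$, and $R(D)=\{f\in \mathrm{PL}(\Gamma): D+\mathrm{div}(f)\ge 0\}$. A tropical linear combination of $f_1,\dots,f_n$ is $\min\{f_1+a_1,\dots,f_n+a_n\}$ with $a_i\in\mathbb R$; a tropical submodule is a set closed under these. Functions $f_1,\dots,f_n$ are tropically dependent if for some $a_i \in\mathbb R$ one has $\min_j\{f_j+a_j\}=\min_{j\ne i}\{f_j+a_j\}$ for every $i$. **Tropical linear series.** $(D,\Sigma)$ is a *tropical linear series of rank $r$* if $\Sigma\subseteq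 R(D)$ is a finitely generated tropical submodule such that (1) for every effective divisor $E$ of degree $r$ there is $f\in\Sigma$ with $\mathrm{div}(f)+D\ge E$, and (2) every set of $r+2$ functions in $\Sigma$ is tropically dependent. **Permutation arrays.** Let $[r]=\{0,\dots,r\}$, with the coordinatewise order on $[r]^d$. For $P\subseteq[r]^d$ and $x\in[r]^d$ put $P[x]=\{y\in P: y\ge x\}$. $P$ is *rankable of rank $s$* if for each $i$ the $i$-th coordinate takes exactly $s+1$ values on $P$; it is *totally rankable* if every $P[x]$ is rankable, and then $\rho_P(x)$ is the rank of $P[x]$. A point $x \in [r]^d$ is *redundant* if it is the coordinatewise minimum of at least two elements of $P$, each having some coordinate in common with $x$; $\overline P$ is the union of $P$ and its redundant points. A *permutation array* of rank $r$ and dimension $d$ is a totally rankable $P\subseteq[r]^d$ of rank $r$ containing none of its redundant points. The standard one of dimension $2$ is $\{(x_1,x_2) \in [r]^2 : x_1+x_2=r\}$. **Slope structures.** An *$r$-slope structure* $\mathfrak S$ on $\Gamma$ consists of a finite set $V\subset\Gamma$ containing all points of valence $\ne 2$; for every tangent vector $\eta$, integers $s^\eta_0<\dots<s^\eta_r$;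 and, for every $v\in\Gamma$, an ordering $\eta_1,\dots,\eta_{\mathrm{val}(v)}$ of $T_v(\Gamma)$ and a permutation array $P_v$ of rank $r$ and dimension $\mathrm{val}(v)$; such that, along each connected component of $\Gamma\setminus V$, $s^\eta$ is the same for all tangent vectors $\eta$ in the same direction and $s^\eta_i+s^\xi_{r-i}=0$ for $\eta,\xi$ in opposite directions, and such that $P_v$ is the standard permutation array for $v\notin V$. Let $R(\mathfrak S)$ be the set of $f\in \mathrm{PL}(\Gamma)$ such that for every $v$ there is $\partial_v(f)=(x_1,\dots,x_{\mathrm{val}(v)})\in\overline{P_v}$ with $\mathrm{sl}_{\eta_k}(f)=s^{\eta_k}_{x_k}$ for all $k$; for such $f$ put $\rho_v(f)=\rho_{P_v}(\partial_v(f))$. (At a point of valence $0$ conditions on the rank of an array are vacuous.) **Structured; combinatorial limit linear series.** A tropical linear series $(D,\Sigma)$ of rank $r$ is *structured* if $\Sigma\subseteq R(\mathfrak S)$ for some $r$-slope structure $\mathfrak S$. A pair $(D,\Sigma)$ is a *combinatorial limit linear series of rank $r$* if $\Sigma\subseteq R(D)$ is a finitely generated tropical submodule, closed in $\mathrm{PL}(\Gamma)$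 for the topology of the maximum norm, every $r+2$ elements of $\Sigma$ are tropically dependent, and there is an $r$-slope structure $\mathfrak S$ with $\Sigma\subseteq R(D)\cap R(\mathfrak S)$ such that for every effective divisor $E$ of degree $r$ some $f\in\Sigma$ satisfies both $\mathrm{div}(f)+D\ge E$ and $\rho_v(f)\ge E(v)$ for all $v\in\Gamma$. **Theorem.** A tropical linear series $(D,\Sigma)$ of rank $r$ on $\Gamma$ is structured if and only if it is a combinatorial limit linear series of rank $r$. -/

import Mathlib

/-! ## Dot arrays, total rankability, permutation arrays

`[r] = {0, …, r}` is `Fin (r + 1)`, and a `d`-dimensional dot array in `[r]^d` is a subset of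
`Fin d → Fin (r + 1)`, which carries the coordinatewise order. -/

/-- A `d`-dimensional dot array in `[r]^d`. -/
abbrev DotArray (d r : ℕ) : Type := Set (Fin d → Fin (r + 1))

namespace DotArray

variable {d r : ℕ}

/-- The principal subarray `P[x]`: the dotted positions `y ⪰ x`. -/
def principal (P : DotArray d r) (x : Fin d → Fin (r + 1)) : DotArray d r :=
  {y | y ∈ P ∧ x ≤ y}

/-- The rank along the `i`-axis: the number of values of the `i`-th coordinate on `P`, minus one. -/
noncomputable def axisRank (P : DotArray d r) (i : Fin d) : ℤ :=
  (((fun x : Fin d → Fin (r + 1) => x i) '' P).ncard : ℤ) - 1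

/-- `P` is rankable of rank `s`. -/
def HasRank (P : DotArray d r) (s : ℤ) : Prop :=
  ∀ i, P.axisRank i = s

/-- Every principal subarray is rankable. -/
def TotallyRankable (P : DotArray d r) : Prop :=
  ∀ x, ∃ s, (P.principal x).HasRank s

/-- The redundant positions `R(P)`: meets of at least two dotted positions, each of which has a
coordinate in common with the meet. -/
def redundant (P : DotArray d r) : DotArray d r :=
  {x | ∃ H : Finset (Fin d → Fin (r + 1)), (H : Set (Fin d → Fin (r + 1))) ⊆ P ∧ 2 ≤ H.card ∧
    IsGLB (H : Set (Fin d → Fin (r + 1))) x ∧ ∀ y ∈ H, ∃ i, y i = x i}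

/-- The redundant closure `P ∪ R(P)`. -/
def redundantClosure (P : DotArray d r) : DotArray d r :=
  P ∪ P.redundant

/-- Permutation arrays of rank `r` and dimension `d`. -/
structure IsPermutationArray (P : DotArray d r) : Prop where
  totallyRankable : P.TotallyRankable
  hasRank : P.HasRank r
  not_dotted : Disjoint P P.redundant

/-- The standard permutation array `{x ∈ [r]^d : x_1 + ⋯ + x_d = r}`. -/
def standard (d r : ℕ) : DotArray d r :=
  {x | ∑ i, (x i : ℕ) = r}

end DotArray

/-! ## Metric graphs, piecewise linear functions, divisors -/

/-- A metric graph given by a model: a graph with vertex type `V` and edge type `E` (loops and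
multiple edges allowed, `V` and `E` are finite in use), each edge `e` being an interval of finite
positive length `len e`, with an arbitrary reference orientation from `src e` to `tgt e`. -/
structure MetricGraph (V E : Type*) where
  src : E → V
  tgt : E → V
  len : E → ℝ
  len_pos : ∀ e, 0 < len e

namespace MetricGraph

variable {V E : Type*}

/-- The points of the metric graph: the vertices, and the interior points of the edges (at
distance `t` from the source of the edge). -/
inductive Point (Γ : MetricGraph V E) where
  | vertex (v : V) : Point Γ
  | interior (e : E) (t : ℝ) (ht : t ∈ Set.Ioo 0 (Γ.len e)) : Point Γ

variable (Γ : MetricGraph V E)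

/-- The parametrization of the closed edge `e` by `[0, len e]`, with `0 ↦ src e` and
`len e ↦ tgt e` (constant outside of this interval). -/
noncomputable def point (e : E) (t : ℝ) : Γ.Point :=
  if h : t ∈ Set.Ioo 0 (Γ.len e) then .interior e t h
  else if t ≤ 0 then .vertex (Γ.src e) else .vertex (Γ.tgt e)

/-- A tangent vector of the metric graph: it sits on the edge `edge` at position `pos` and points
towards the target of the edge (`toTgt = true`) or towards its source (`toTgt = false`). -/
@[ext]
structure Tangent where
  edge : E
  pos : ℝ
  toTgt : Bool
  pos_mem : pos ∈ Set.Icc 0 (Γ.len edge)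
  lt_len : toTgt = true → pos < Γ.len edge
  pos_pos : toTgt = false → 0 < pos

variable {Γ}

/-- The point at which a tangent vector is based. -/
noncomputable def Tangent.base (η : Γ.Tangent) : Γ.Point := Γ.point η.edge η.pos

/-- `1` or `-1`, according to the direction of the tangent vector in the edge coordinate. -/
noncomputable def Tangent.sign (η : Γ.Tangent) : ℝ := if η.toTgt then 1 else -1

variable (Γ)

/-- `T_v(Γ)`, the outgoing tangent vectors at `v`. -/
abbrev TangentAt (v : Γ.Point) : Type _ := {η : Γ.Tangent // η.base = v}

/-- A tangent vector at a given point is determined by its edge and its direction. -/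
theorem tangentAt_injective (v : Γ.Point) :
    Function.Injective (fun η : Γ.TangentAt v => (η.1.edge, η.1.toTgt)) := by
  rintro ⟨⟨e, s, b, hs, hs1, hs2⟩, h⟩ ⟨⟨e', t, b', ht, ht1, ht2⟩, h'⟩ heq
  obtain ⟨rfl, rfl⟩ : e = e' ∧ b = b' := by simpa using heq
  have hpt : Γ.point e s = Γ.point e t := h.trans h'.symm
  have hlen := Γ.len_pos e
  suffices s = t by subst this; rfl
  simp only [Set.mem_Icc] at hs ht
  unfold point at hpt
  cases b
  · have h1 := hs2 rfl
    have h2 := ht2 rfl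
    by_cases hs3 : s < Γ.len e <;> by_cases ht3 : t < Γ.len e <;>
      simp [h1, h2, hs3, ht3, not_le.mpr h1, not_le.mpr h2] at hpt
    · exact hpt
    · linarith
  · have h1 := hs1 rfl
    have h2 := ht1 rfl
    by_cases hs3 : 0 < s <;> by_cases ht3 : 0 < t <;>
      simp [h1, h2, hs3, ht3, not_lt.mp] at hpt
    · exact hpt
    · linarith

instance [Finite E] (v : Γ.Point) : Finite (Γ.TangentAt v) :=
  Finite.of_injective _ (Γ.tangentAt_injective v)

noncomputable instance [Finite E] (v : Γ.Point) : Fintype (Γ.TangentAt v) :=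
  Fintype.ofFinite _

/-- The valence `|T_v(Γ)|` of a point. -/
noncomputable def val [Finite E] (v : Γ.Point) : ℕ := Fintype.card (Γ.TangentAt v)

/-- `PL(Γ)`: the continuous piecewise linear functions with integer slopes. On each edge there is
a finite set `B` of breakpoints such that the function is affine with integer slope on every
closed subinterval whose interior contains no breakpoint. -/
def PL : Set (Γ.Point → ℝ) :=
  {f | ∀ e, ContinuousOn (fun t => f (Γ.point e t)) (Set.Icc 0 (Γ.len e)) ∧
    ∃ B : Finset ℝ, ∀ s t, 0 ≤ s → s < t → t ≤ Γ.len e → (∀ b ∈ B, b ∉ Set.Ioo s t) →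
      ∃ m : ℤ, ∀ u ∈ Set.Icc s t, f (Γ.point e u) = f (Γ.point e s) + m * (u - s)}

variable {Γ}

/-- The outgoing slope `sl_η(f)`: the one-sided derivative of `f` along `η`. -/
noncomputable def outSlope (f : Γ.Point → ℝ) (η : Γ.Tangent) : ℝ :=
  derivWithin (fun u => f (Γ.point η.edge (η.pos + η.sign * u))) (Set.Ici 0) 0

/-- The order of vanishing `ord_v(f)`, which is the coefficient of `div(f)` at `v`. -/
noncomputable def ord [Finite E] (f : Γ.Point → ℝ) (v : Γ.Point) : ℝ :=
  - ∑ η : Γ.TangentAt v, outSlope f η.1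

variable (Γ)

/-- Divisors: finitely supported formal integer sums of points. -/
abbrev Divisor : Type _ := Γ.Point →₀ ℤ

variable {Γ}

/-- The degree of a divisor. -/
def Divisor.degree (D : Γ.Divisor) : ℤ := D.sum fun _ n => n

/-- The Baker-Norine rank property: `div(f) + D ≥ F`, coefficient by coefficient. -/
def BNRP [Finite E] (D F : Γ.Divisor) (f : Γ.Point → ℝ) : Prop :=
  ∀ v, (F v : ℝ) ≤ ord f v + D v

/-- The complete linear series `R(D) = {f ∈ PL(Γ) : D + div(f) ≥ 0}`. -/
def completeSeries [Finite E] (D : Γ.Divisor) : Set (Γ.Point → ℝ) :=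
  {f | f ∈ Γ.PL ∧ ∀ v, 0 ≤ (D v : ℝ) + ord f v}

/-! ## Tropical combinations and tropical dependence -/

/-- The tropical linear combination `min {f_0 + a_0, …, f_n + a_n}`. -/
noncomputable def tropComb {n : ℕ} (f : Fin (n + 1) → Γ.Point → ℝ) (a : Fin (n + 1) → ℝ) :
    Γ.Point → ℝ :=
  fun x => Finset.univ.inf' Finset.univ_nonempty fun i => f i x + a i

/-- The set `⟨S⟩` of all tropical linear combinations of elements of `S`. -/
def tropSpan (S : Set (Γ.Point → ℝ)) : Set (Γ.Point → ℝ) :=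
  {g | ∃ (n : ℕ) (f : Fin (n + 1) → Γ.Point → ℝ) (a : Fin (n + 1) → ℝ),
    (∀ i, f i ∈ S) ∧ g = tropComb f a}

/-- A tropical submodule: closed under tropical linear combinations. -/
def IsTropicalSubmodule (L : Set (Γ.Point → ℝ)) : Prop :=
  ∀ (n : ℕ) (f : Fin (n + 1) → Γ.Point → ℝ) (a : Fin (n + 1) → ℝ),
    (∀ i, f i ∈ L) → tropComb f a ∈ L

/-- Generated by finitely many of its elements. -/
def IsFinitelyGenerated (L : Set (Γ.Point → ℝ)) : Prop :=
  ∃ S : Set (Γ.Point → ℝ), S.Finite ∧ S ⊆ L ∧ L = tropSpan S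

/-- Tropical dependence: for suitable real `a_i`, the minimum of the `f_k + a_k` is at every point
also the minimum of the `f_j + a_j` with `j ≠ i`, for each `i`. -/
def TropicallyDependent {n : ℕ} (f : Fin n → Γ.Point → ℝ) : Prop :=
  ∃ a : Fin n → ℝ, ∀ (i : Fin n) (x : Γ.Point),
    ∃ j, j ≠ i ∧ ∀ k, f j x + a j ≤ f k x + a k

/-- Every set of `n` functions in `L` is tropically dependent. -/
def EveryDependent (n : ℕ) (L : Set (Γ.Point → ℝ)) : Prop :=
  ∀ f : Fin n → Γ.Point → ℝ, Function.Injective f → (∀ i, f i ∈ L) → TropicallyDependent f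

/-- `(D, L)` is a tropical linear series of rank `r`. -/
structure IsTropicalLinearSeries [Finite E] (r : ℕ) (D : Γ.Divisor) (L : Set (Γ.Point → ℝ)) :
    Prop where
  subset : L ⊆ completeSeries D
  submodule : IsTropicalSubmodule L
  finitelyGenerated : IsFinitelyGenerated L
  rank : ∀ F : Γ.Divisor, 0 ≤ F → F.degree = r → ∃ f ∈ L, BNRP D F f
  dependent : EveryDependent (r + 2) L

/-! ## Slope structures -/

/-- `Along W b η ξ`: the tangent vectors `η` and `ξ` are directed along the same connected component
of `Γ \ W`, in the same direction if `b = true` and in opposite directions if `b = false`.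
It is used for sets `W` containing all points of valence different from `2`, so that the
components are open arcs or circles. Two vectors of one edge that face each other, with no point
of `W` strictly between them, are opposite; so are the two tangent vectors at a point outside
`W`; everything else is obtained by moving along the component. -/
inductive Along (W : Set Γ.Point) : Bool → Γ.Tangent → Γ.Tangent → Prop
  | facing (η ξ : Γ.Tangent) (he : η.edge = ξ.edge) (hη : η.toTgt = true) (hξ : ξ.toTgt = false)
      (hlt : η.pos < ξ.pos) (hW : ∀ u ∈ Set.Ioo η.pos ξ.pos, Γ.point η.edge u ∉ W) :
      Along W false η ξ
  | through (η ξ : Γ.Tangent) (hb : η.base = ξ.base) (hne : η ≠ ξ) (hW : η.base ∉ W) :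
      Along W false η ξ
  | symm {b : Bool} {η ξ : Γ.Tangent} : Along W b η ξ → Along W b ξ η
  | trans {b c : Bool} {η ξ ζ : Γ.Tangent} :
      Along W b η ξ → Along W c ξ ζ → Along W (b == c) η ζ

variable (Γ)

/-- An `r`-slope structure on `Γ`, with its finite set `W` of special points. -/
structure SlopeStructure [Finite E] (r : ℕ) where
  /-- the finite set of special points, containing all points of valence different from `2` -/
  W : Finset Γ.Point
  mem_W : ∀ v, Γ.val v ≠ 2 → v ∈ W
  /-- the integers `s_0^η < ⋯ < s_r^η` -/
  s : Γ.Tangent → Fin (r + 1) → ℤ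
  s_strictMono : ∀ η, StrictMono (s η)
  /-- an ordering of the tangent vectors at each point -/
  order : ∀ v, Fin (Γ.val v) ≃ Γ.TangentAt v
  /-- the permutation arrays `P_v` -/
  P : ∀ v, DotArray (Γ.val v) r
  P_perm : ∀ v, (P v).IsPermutationArray
  s_same : ∀ η ξ, Along (W : Set Γ.Point) true η ξ → s η = s ξ
  s_opposite : ∀ η ξ, Along (W : Set Γ.Point) false η ξ → ∀ i : Fin (r + 1),
    s η i + s ξ i.rev = 0
  P_standard : ∀ v, v ∉ W → P v = DotArray.standard (Γ.val v) r

variable {Γ}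

namespace SlopeStructure

variable [Finite E] {r : ℕ} (𝔖 : Γ.SlopeStructure r)

/-- `𝔖.IsIndex f v x` says that `∂_v(f) = x`, that is, `sl_η(f) = s_j^η` whenever `η` is the `k`-th
tangent vector at `v` and `j = x_k`. There is at most one such `x`. -/
def IsIndex (f : Γ.Point → ℝ) (v : Γ.Point) (x : Fin (Γ.val v) → Fin (r + 1)) : Prop :=
  ∀ k, outSlope f (𝔖.order v k).1 = 𝔖.s (𝔖.order v k).1 (x k)

/-- `R(𝔖)`: the functions in `PL(Γ)` that are compatible with `𝔖`, i.e. all slopes of `f` at `v` are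
among the prescribed ones and `∂_v(f)` lies in the redundant closure of `P_v`. -/
def series : Set (Γ.Point → ℝ) :=
  {f | f ∈ Γ.PL ∧ ∀ v, ∃ x, 𝔖.IsIndex f v x ∧ x ∈ (𝔖.P v).redundantClosure}

/-- The local rank property `ρ_v(f) ≥ F(v)` for all `v`, where `ρ_v(f)` is the rank of the
principal subarray of `P_v` at `∂_v(f)`. -/
def LRP (F : Γ.Divisor) (f : Γ.Point → ℝ) : Prop :=
  ∀ v, ∃ x, 𝔖.IsIndex f v x ∧ ∃ ρ : ℤ, ((𝔖.P v).principal x).HasRank ρ ∧ F v ≤ ρ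

end SlopeStructure

/-- Closed in `PL(Γ)` for the topology of the norm `‖f‖ = max |f|`. -/
def IsUniformlyClosed (L : Set (Γ.Point → ℝ)) : Prop :=
  ∀ f ∈ Γ.PL, (∀ ε > 0, ∃ g ∈ L, ∀ x, |f x - g x| < ε) → f ∈ L

/-- Being structured: contained in `R(𝔖)` for some `r`-slope structure `𝔖`. -/
def IsStructured [Finite E] (r : ℕ) (L : Set (Γ.Point → ℝ)) : Prop :=
  ∃ 𝔖 : Γ.SlopeStructure r, L ⊆ 𝔖.series

/-- The tropical submodule `L ⊆ R(D)` is admissible of rank `r`. -/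
structure IsAdmissible [Finite E] (r : ℕ) (D : Γ.Divisor) (L : Set (Γ.Point → ℝ)) : Prop where
  subset : L ⊆ completeSeries D
  submodule : IsTropicalSubmodule L
  closed : IsUniformlyClosed L
  slopes : ∃ 𝔖 : Γ.SlopeStructure r, L ⊆ completeSeries D ∩ 𝔖.series ∧
    ∀ F : Γ.Divisor, 0 ≤ F → F.degree = r → ∃ f ∈ L, BNRP D F f ∧ 𝔖.LRP F f

/-- `(D, L)` is a combinatorial limit linear series of rank `r`. -/
structure IsCombinatorialLimitLinearSeries [Finite E] (r : ℕ) (D : Γ.Divisor)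
    (L : Set (Γ.Point → ℝ)) : Prop where
  admissible : IsAdmissible r D L
  finitelyGenerated : IsFinitelyGenerated L
  dependent : EveryDependent (r + 2) L

end MetricGraph

/-! Only the passage from structured to combinatorial limit needs work. Closedness follows from
finite generation: a bounded uniform limit `g` of combinations of generators `s i` is itself the
combination with coefficients `sup (g - s i)` (`eq_tropComb_iSup`).

For the local rank property, suppose first that the prescribed zeros are simple and lie away from
the special points. Any function with the Baker-Norine property then has positive order at each of
them, so its two slopes there do not cancel, and in the standard array this forces local rank at
least one (`one_le_rank_of_ord_pos`).

A general divisor is reached by pushing its zeros, one at a time, off the special points and letting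
them return. Up to constants, the functions realizing the pushed divisors have coefficients in a
compact set, so they accumulate at some `f` in the series. Away from the support of `D` these
functions bend downwards, hence lie below their tangents; as slopes are integers, the slopes of `f`
at the special points are at most those of a nearby approximant, and smaller by at least one in the
direction from which the zero returns (`exists_limit_outSlope_le`). Smaller slopes mean a smaller
index in the dot array. The rank of the principal subarray does not drop, and it grows by at least
one as soon as one coordinate drops strictly (`HasRank.lt`). So the order and the local rank both
gain the missing unit. -/

section

open Set Filter Topology

/-! ### Piecewise linear functions of one real variable -/

/-- Piecewise linearity with integer slopes on `[0, R]`, with breakpoints in `B`. -/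
def PiecewiseLinearOn (φ : ℝ → ℝ) (B : Finset ℝ) (R : ℝ) : Prop :=
  ∀ s t, 0 ≤ s → s < t → t ≤ R → (∀ b ∈ B, b ∉ Ioo s t) →
    ∃ m : ℤ, ∀ u ∈ Icc s t, φ u = φ s + m * (u - s)

/-- At every point of `(0, R)` the slope of `φ` on the right is at most its slope on the left. -/
def BendsDownOn (φ : ℝ → ℝ) (R : ℝ) : Prop :=
  ∀ u ∈ Ioo 0 R, ∀ m₁ m₂ δ : ℝ, 0 < δ → (∀ x ∈ Icc (u - δ) u, φ x = φ u + m₁ * (x - u)) →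
    (∀ x ∈ Icc u (u + δ), φ x = φ u + m₂ * (x - u)) → m₂ ≤ m₁

namespace PiecewiseLinearOn

variable {φ : ℝ → ℝ} {B : Finset ℝ} {R : ℝ}

theorem eventually_right (h : PiecewiseLinearOn φ B R) {s : ℝ} (hs : 0 ≤ s) (hR : s < R) :
    ∃ m : ℤ, ∀ᶠ t in 𝓝[>] s, t ≤ R ∧ ∀ u ∈ Icc s t, φ u = φ s + m * (u - s) := by
  have h1 : ∀ᶠ t in 𝓝[>] s, ∀ b ∈ B, b ∉ Ioo s t := by
    rw [Finset.eventually_all]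
    intro b _
    rcases le_or_gt b s with hb | hb
    · exact Eventually.of_forall fun t ht => absurd ht.1 (not_lt.2 hb)
    · filter_upwards [Ioo_mem_nhdsGT hb] with t ht hbt
      exact absurd hbt.2 (not_lt.2 ht.2.le)
  obtain ⟨t, ⟨hB, htR⟩, hst⟩ :=
    ((h1.and (Ioo_mem_nhdsGT hR)).and (self_mem_nhdsWithin : Ioi s ∈ 𝓝[>] s)).exists
  obtain ⟨m, hm⟩ := h s t hs hst htR.2.le hB
  refine ⟨m, ?_⟩
  filter_upwards [Ioo_mem_nhdsGT hst] with t' ht'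
  exact ⟨ht'.2.le.trans htR.2.le, fun u hu => hm u ⟨hu.1, hu.2.trans ht'.2.le⟩⟩

theorem exists_left (h : PiecewiseLinearOn φ B R) {t : ℝ} (ht : 0 < t) (hR : t ≤ R) :
    ∃ m : ℤ, ∃ δ > 0, δ ≤ t ∧ ∀ u ∈ Icc (t - δ) t, φ u = φ t + m * (u - t) := by
  have h1 : ∀ᶠ s in 𝓝[<] t, ∀ b ∈ B, b ∉ Ioo s t := by
    rw [Finset.eventually_all]
    intro b _
    rcases le_or_gt t b with hb | hb
    · exact Eventually.of_forall fun s hs => absurd hs.2 (not_lt.2 hb)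
    · filter_upwards [Ioo_mem_nhdsLT hb] with s hs hbs
      exact absurd hbs.1 (not_lt.2 hs.1.le)
  obtain ⟨s, hB, hs⟩ := (h1.and (Ioo_mem_nhdsLT ht)).exists
  obtain ⟨m, hm⟩ := h s t hs.1.le hs.2 hR hB
  refine ⟨m, t - s, sub_pos.2 hs.2, by linarith [hs.1], fun u hu => ?_⟩
  rw [hm u ⟨by linarith [hu.1], hu.2⟩, hm t ⟨hs.2.le, le_rfl⟩]
  ring

/-- A piecewise linear function that bends down lies below its tangents, and its slopes decrease. -/
theorem le_tangent (h : PiecewiseLinearOn φ B R) (hc : BendsDownOn φ R) {s t : ℝ} (hs : 0 ≤ s)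
    (hst : s < t) (ht : t ≤ R) {m δ : ℝ} (hδ : 0 < δ)
    (hm : ∀ u ∈ Icc s (s + δ), φ u = φ s + m * (u - s)) :
    φ t ≤ φ s + m * (t - s) ∧ ∀ m₁ δ₁ : ℝ, 0 < δ₁ →
      (∀ u ∈ Icc (t - δ₁) t, φ u = φ t + m₁ * (u - t)) → m₁ ≤ m := by
  -- The induction is on the number of breakpoints in `(s, t)`; the bound on left slopes at `t` is
  -- carried along because the next affine piece is compared with it.
  induction hn : (B.filter (· ∈ Ioo s t)).card using Nat.strong_induction_on generalizing t with
  | _ n ih =>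
  have affine : ∀ c, s ≤ c → c < t → (∀ b ∈ B, b ∉ Ioo c t) → ∃ m' : ℝ,
      (∀ u ∈ Icc c t, φ u = φ c + m' * (u - c)) ∧ ∀ m₁ δ₁ : ℝ, 0 < δ₁ →
      (∀ u ∈ Icc (t - δ₁) t, φ u = φ t + m₁ * (u - t)) → m₁ = m' := by
    intro c hsc hct hB
    obtain ⟨m', hm'⟩ := h c t (hs.trans hsc) hct ht hB
    refine ⟨m', hm', fun m₁ δ₁ hδ₁ h₁ => ?_⟩
    have hu : max c (t - δ₁) < t := max_lt hct (by linarith)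
    have e1 := hm' _ ⟨le_max_left c (t - δ₁), hu.le⟩
    have e2 := h₁ _ ⟨le_max_right c (t - δ₁), hu.le⟩
    have e3 := hm' t ⟨hct.le, le_rfl⟩
    have : (m₁ - m') * (max c (t - δ₁) - t) = 0 := by linarith
    rcases mul_eq_zero.1 this with h0 | h0 <;> linarith
  rcases (B.filter (· ∈ Ioo s t)).eq_empty_or_nonempty with he | hne
  · obtain ⟨m', hm', huniq⟩ := affine s le_rfl hst fun b hb hbs =>
      Finset.notMem_empty b (he ▸ Finset.mem_filter.2 ⟨hb, hbs⟩)
    have hu : s < min t (s + δ) := lt_min hst (by linarith)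
    have e1 := hm' _ ⟨hu.le, min_le_left _ _⟩
    have e2 := hm _ ⟨hu.le, min_le_right _ _⟩
    have hmm : m' = m := by
      have : (m' - m) * (min t (s + δ) - s) = 0 := by linarith
      rcases mul_eq_zero.1 this with h0 | h0 <;> linarith
    subst hmm
    exact ⟨(hm' t ⟨hst.le, le_rfl⟩).le, fun m₁ δ₁ hδ₁ h₁ => (huniq m₁ δ₁ hδ₁ h₁).le⟩
  -- Beyond the last breakpoint `c` the function is affine. Its slope there is at most the left
  -- slope at `c`, which the induction bounds by `m`.
  · set c := (B.filter (· ∈ Ioo s t)).max' hne with hcdef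
    have hcmem := Finset.max'_mem _ hne
    rw [← hcdef] at hcmem
    obtain ⟨hcB, hcs, hct⟩ := Finset.mem_filter.1 hcmem
    obtain ⟨m', hm', huniq⟩ := affine c hcs.le hct fun b hb hbs =>
      (Finset.le_max' _ b (Finset.mem_filter.2 ⟨hb, hcs.trans hbs.1, hbs.2⟩)).not_gt hbs.1
    have hcard : (B.filter (· ∈ Ioo s c)).card < n := by
      rw [← hn]
      refine Finset.card_lt_card ⟨fun b hb => ?_, fun hsub => ?_⟩
      · obtain ⟨h1, h2⟩ := Finset.mem_filter.1 hb
        exact Finset.mem_filter.2 ⟨h1, h2.1, h2.2.trans hct⟩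
      · exact lt_irrefl _ (Finset.mem_filter.1 (hsub hcmem)).2.2
    obtain ⟨ih1, ih2⟩ := ih _ hcard hcs (hct.le.trans ht) rfl
    obtain ⟨m₀, δ₀, hδ₀, -, hm₀⟩ := h.exists_left (hs.trans_lt hcs) (hct.le.trans ht)
    have hle := ih2 m₀ δ₀ hδ₀ hm₀
    have hbend : m' ≤ m₀ := by
      refine hc c ⟨hs.trans_lt hcs, hct.trans_le ht⟩ m₀ m' (min δ₀ (t - c))
        (lt_min hδ₀ (sub_pos.2 hct)) (fun x hx => hm₀ x ⟨?_, hx.2⟩) fun x hx => hm' x ⟨hx.1, ?_⟩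
      · linarith [hx.1, min_le_left δ₀ (t - c)]
      · linarith [hx.2, min_le_right δ₀ (t - c)]
    refine ⟨?_, fun m₁ δ₁ hδ₁ h₁ => (huniq m₁ δ₁ hδ₁ h₁).trans_le (hbend.trans hle)⟩
    rw [hm' t ⟨hct.le, le_rfl⟩]
    nlinarith [mul_le_mul_of_nonneg_right (hbend.trans hle) (sub_pos.2 hct).le]

end PiecewiseLinearOn

/-! ### Functions and orders of vanishing along a tangent vector -/

namespace MetricGraph

variable {V E : Type*} {Γ : MetricGraph V E}

/-- The point reached from the base of `η` after moving by `u` along `η`. -/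
noncomputable def Tangent.ray (η : Γ.Tangent) (u : ℝ) : Γ.Point :=
  Γ.point η.edge (η.pos + η.sign * u)

/-- The length of the part of the edge that lies ahead of `η`. -/
noncomputable def Tangent.room (η : Γ.Tangent) : ℝ :=
  if η.toTgt then Γ.len η.edge - η.pos else η.pos

theorem Tangent.room_pos (η : Γ.Tangent) : 0 < η.room := by
  unfold Tangent.room
  split_ifs with h
  · exact sub_pos.2 (η.lt_len h)
  · exact η.pos_pos (by simpa using h)

theorem Tangent.ray_mem_Ioo (η : Γ.Tangent) {u : ℝ} (hu : u ∈ Ioo 0 η.room) :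
    η.pos + η.sign * u ∈ Ioo 0 (Γ.len η.edge) := by
  obtain ⟨h0, h1⟩ := hu
  have hp := η.pos_mem
  unfold Tangent.room at h1
  unfold Tangent.sign
  split_ifs at h1 ⊢ <;> constructor <;> linarith [hp.1, hp.2]

theorem Tangent.ray_injOn (η : Γ.Tangent) : InjOn η.ray (Ioo 0 η.room) := by
  intro u hu v hv huv
  have hu' := η.ray_mem_Ioo hu
  have hv' := η.ray_mem_Ioo hv
  simp only [Tangent.ray, point, dif_pos hu', dif_pos hv', Point.interior.injEq, true_and,
    add_right_inj] at huv
  unfold Tangent.sign at huv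
  split_ifs at huv <;> linarith

theorem Tangent.eventually_ray_notMem (η : Γ.Tangent) {K : Set Γ.Point} (hK : K.Finite) :
    ∀ᶠ u in 𝓝[>] (0 : ℝ), η.ray u ∉ K := by
  have hfin : (Ioo 0 η.room ∩ η.ray ⁻¹' K).Finite :=
    Set.Finite.of_finite_image (hK.subset (by rintro _ ⟨u, hu, rfl⟩; exact hu.2))
      (η.ray_injOn.mono inter_subset_left)
  have h0 : (0 : ℝ) ∉ Ioo 0 η.room ∩ η.ray ⁻¹' K := fun h => lt_irrefl _ h.1.1
  have := hfin.isClosed.isOpen_compl.mem_nhds h0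
  filter_upwards [nhdsWithin_le_nhds this, Ioo_mem_nhdsGT η.room_pos] with u hu hu'
  exact fun h => hu ⟨hu', h⟩

theorem piecewiseLinearOn_ray {f : Γ.Point → ℝ} (hf : f ∈ Γ.PL) (η : Γ.Tangent) :
    ∃ B, PiecewiseLinearOn (fun u => f (η.ray u)) B η.room := by
  obtain ⟨-, B, hB⟩ := hf η.edge
  have hp := η.pos_mem
  unfold Tangent.room Tangent.ray Tangent.sign
  split_ifs with h
  · refine ⟨B.image (· - η.pos), fun s t hs hst ht hst' => ?_⟩
    obtain ⟨m, hm⟩ := hB (η.pos + s) (η.pos + t) (by linarith [hp.1]) (by linarith) (by linarith)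
      fun b hb hbs => hst' (b - η.pos) (Finset.mem_image_of_mem _ hb)
        ⟨by linarith [hbs.1], by linarith [hbs.2]⟩
    refine ⟨m, fun u hu => ?_⟩
    have := hm (η.pos + u) ⟨by linarith [hu.1], by linarith [hu.2]⟩
    simp only [one_mul, this]
    ring
  · refine ⟨B.image (η.pos - ·), fun s t hs hst ht hst' => ?_⟩
    obtain ⟨m, hm⟩ := hB (η.pos - t) (η.pos - s) (by linarith) (by linarith) (by linarith [hp.2])
      fun b hb hbs => hst' (η.pos - b) (Finset.mem_image_of_mem _ hb)
        ⟨by linarith [hbs.2], by linarith [hbs.1]⟩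
    refine ⟨-m, fun u hu => ?_⟩
    have h1 := hm (η.pos - u) ⟨by linarith [hu.2], by linarith [hu.1]⟩
    have h2 := hm (η.pos - s) ⟨by linarith, le_rfl⟩
    simp only [neg_one_mul, ← sub_eq_add_neg, h1, h2]
    push_cast
    ring

theorem outSlope_eq {f : Γ.Point → ℝ} {η : Γ.Tangent} {m δ : ℝ} (hδ : 0 < δ)
    (h : ∀ u ∈ Icc 0 δ, f (η.ray u) = f (η.ray 0) + m * u) : outSlope f η = m := by
  have hd : HasDerivWithinAt (fun u => f (η.ray 0) + m * u) m (Ici 0) 0 := by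
    simpa using (((hasDerivAt_id (0 : ℝ)).const_mul m).const_add (f (η.ray 0))).hasDerivWithinAt
  refine HasDerivWithinAt.derivWithin (f' := m) (hd.congr_of_eventuallyEq ?_ ?_)
    (uniqueDiffOn_Ici 0 0 self_mem_Ici)
  · filter_upwards [Icc_mem_nhdsGE hδ] with u hu using h u hu
  · exact h 0 ⟨le_rfl, hδ.le⟩

/-- The integrality of the slope is what later turns approximate inequalities between slopes into
exact ones. -/
theorem eventually_outSlope {f : Γ.Point → ℝ} (hf : f ∈ Γ.PL) (η : Γ.Tangent) :
    ∃ m : ℤ, outSlope f η = m ∧ ∀ᶠ t in 𝓝[>] (0 : ℝ), t ≤ η.room ∧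
      ∀ u ∈ Icc 0 t, f (η.ray u) = f (η.ray 0) + m * u := by
  obtain ⟨B, hB⟩ := piecewiseLinearOn_ray hf η
  obtain ⟨m, hm⟩ := hB.eventually_right le_rfl η.room_pos
  simp only [sub_zero] at hm
  obtain ⟨t, ht, ht0⟩ := (hm.and (self_mem_nhdsWithin : Ioi (0:ℝ) ∈ _)).exists
  exact ⟨m, outSlope_eq ht0 ht.2, hm⟩

/-- The tangent vector at an interior point of an edge, in a given direction. -/
def interiorTangent (e : E) (t : ℝ) (ht : t ∈ Ioo 0 (Γ.len e)) (b : Bool) : Γ.Tangent :=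
  ⟨e, t, b, Ioo_subset_Icc_self ht, fun _ => ht.2, fun _ => ht.1⟩

theorem ord_interior [Finite E] (f : Γ.Point → ℝ) (e : E) (t : ℝ) (ht : t ∈ Ioo 0 (Γ.len e)) :
    ord f (Γ.point e t) =
      -(outSlope f (interiorTangent e t ht true) + outSlope f (interiorTangent e t ht false)) := by
  classical
  let T (b : Bool) : Γ.TangentAt (Γ.point e t) := ⟨interiorTangent e t ht b, rfl⟩
  have hbij : Function.Bijective T := by
    refine ⟨fun b b' h => congrArg (fun η => η.1.toTgt) h, ?_⟩
    rintro ⟨⟨e', t', b, hp, h1, h2⟩, hb⟩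
    refine ⟨b, Subtype.ext ?_⟩
    simp only [Tangent.base, point, dif_pos ht] at hb
    split_ifs at hb
    cases hb
    rfl
  unfold ord
  rw [← (Equiv.ofBijective T hbij).sum_comp, Fintype.sum_bool]
  rfl

/-- In the interior of an edge, the order of vanishing is the drop of the slope. -/
theorem ord_ray [Finite E] {f : Γ.Point → ℝ} {η : Γ.Tangent} {u m₁ m₂ δ : ℝ}
    (hu : u ∈ Ioo 0 η.room) (hδ : 0 < δ)
    (h₁ : ∀ x ∈ Icc (u - δ) u, f (η.ray x) = f (η.ray u) + m₁ * (x - u))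
    (h₂ : ∀ x ∈ Icc u (u + δ), f (η.ray x) = f (η.ray u) + m₂ * (x - u)) :
    ord f (η.ray u) = m₁ - m₂ := by
  have ht := η.ray_mem_Ioo hu
  have key := ord_interior f η.edge _ ht
  have hfwd : outSlope f (interiorTangent η.edge _ ht η.toTgt) = m₂ := by
    refine outSlope_eq hδ fun x hx => ?_
    have hr : ∀ y, (interiorTangent η.edge _ ht η.toTgt).ray y = η.ray (u + y) := fun y => by
      simp only [Tangent.ray, interiorTangent, Tangent.sign]
      congr 1
      cases η.toTgt <;> simp <;> ring
    rw [hr, hr, add_zero, h₂ (u + x) ⟨by linarith [hx.1], by linarith [hx.2]⟩]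
    ring
  have hbwd : outSlope f (interiorTangent η.edge _ ht (!η.toTgt)) = -m₁ := by
    refine outSlope_eq hδ fun x hx => ?_
    have hr : ∀ y, (interiorTangent η.edge _ ht (!η.toTgt)).ray y = η.ray (u - y) := fun y => by
      simp only [Tangent.ray, interiorTangent, Tangent.sign]
      congr 1
      cases η.toTgt <;> simp <;> ring
    rw [hr, hr, sub_zero, h₁ (u - x) ⟨by linarith [hx.2], by linarith [hx.1]⟩]
    ring
  change ord f (Γ.point η.edge _) = _
  rw [key]
  cases hb : η.toTgt <;> simp only [hb, Bool.not_true, Bool.not_false] at hfwd hbwd <;>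
    rw [hfwd, hbwd] <;> ring

theorem bendsDownOn_ray [Finite E] {f : Γ.Point → ℝ} {η : Γ.Tangent} {R : ℝ} (hR : R ≤ η.room)
    (h : ∀ u ∈ Ioo 0 R, 0 ≤ ord f (η.ray u)) : BendsDownOn (fun u => f (η.ray u)) R := by
  intro u hu m₁ m₂ δ hδ h₁ h₂
  have := h u hu
  rw [ord_ray ⟨hu.1, hu.2.trans_le hR⟩ hδ h₁ h₂] at this
  linarith

theorem ray_le_tangent [Finite E] {f : Γ.Point → ℝ} (hf : f ∈ Γ.PL) {η : Γ.Tangent} {t : ℝ}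
    (ht : 0 < t) (htR : t ≤ η.room) (h : ∀ u ∈ Ioo 0 t, 0 ≤ ord f (η.ray u)) :
    f (η.ray t) ≤ f (η.ray 0) + outSlope f η * t := by
  obtain ⟨B, hB⟩ := piecewiseLinearOn_ray hf η
  obtain ⟨m, hm, hev⟩ := eventually_outSlope hf η
  obtain ⟨δ, hδ, hδ0⟩ := (hev.and (self_mem_nhdsWithin : Ioi (0:ℝ) ∈ _)).exists
  have hB' : PiecewiseLinearOn (fun u => f (η.ray u)) B t :=
    fun s s' h1 h2 h3 => hB s s' h1 h2 (h3.trans htR)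
  have := (hB'.le_tangent (bendsDownOn_ray htR h) le_rfl ht le_rfl hδ0 (m := m)
    (by simpa using hδ.2)).1
  simpa [hm] using this

/-- At `τ` the slope drops by at least one, so beyond `τ` the function falls behind its initial
tangent at unit rate or faster. -/
theorem ray_le_tangent_of_one_le_ord [Finite E] {f : Γ.Point → ℝ} (hf : f ∈ Γ.PL) {η : Γ.Tangent}
    {τ t : ℝ} (hτ : 0 < τ) (hτt : τ < t) (htR : t ≤ η.room)
    (h : ∀ u ∈ Ioo 0 t, 0 ≤ ord f (η.ray u)) (h1 : 1 ≤ ord f (η.ray τ)) :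
    f (η.ray t) ≤ f (η.ray 0) + outSlope f η * t - (t - τ) := by
  obtain ⟨B, hB⟩ := piecewiseLinearOn_ray hf η
  obtain ⟨m, hm, hev⟩ := eventually_outSlope hf η
  obtain ⟨δ, hδ, hδ0⟩ := (hev.and (self_mem_nhdsWithin : Ioi (0:ℝ) ∈ _)).exists
  have hB' : PiecewiseLinearOn (fun u => f (η.ray u)) B t :=
    fun s s' h1 h2 h3 => hB s s' h1 h2 (h3.trans htR)
  have hc := bendsDownOn_ray htR h
  obtain ⟨e1, e2⟩ := hB'.le_tangent hc le_rfl hτ hτt.le hδ0 (m := m) (by simpa using hδ.2)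
  obtain ⟨m₁, δ₁, hδ₁, -, h₁⟩ := hB'.exists_left hτ hτt.le
  obtain ⟨m₂, hev₂⟩ := hB'.eventually_right hτ.le hτt
  obtain ⟨t', ⟨-, h₂⟩, ht'⟩ := (hev₂.and (self_mem_nhdsWithin : Ioi τ ∈ _)).exists
  have ht'' : τ < t' := ht'
  have e3 := e2 m₁ δ₁ hδ₁ h₁
  have e4 := (hB'.le_tangent hc hτ.le hτt le_rfl (sub_pos.2 ht'') (m := m₂)
    (by simpa using h₂)).1
  have e5 : ord f (η.ray τ) = m₁ - m₂ := by
    refine ord_ray ⟨hτ, hτt.trans_le htR⟩ (lt_min hδ₁ (sub_pos.2 ht''))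
      (fun x hx => h₁ x ⟨?_, hx.2⟩) fun x hx => h₂ x ⟨hx.1, ?_⟩
    · linarith [hx.1, min_le_left δ₁ (t' - τ)]
    · linarith [hx.2, min_le_right δ₁ (t' - τ)]
  rw [hm]
  rw [sub_zero] at e1
  have e6 : (m₂ : ℝ) ≤ m - 1 := by linarith
  have := mul_le_mul_of_nonneg_right e6 (sub_pos.2 hτt).le
  linarith

/-! ### Tropical combinations and compactness of coefficients -/

theorem exists_bound_of_mem_PL [Finite V] [Finite E] {f : Γ.Point → ℝ} (hf : f ∈ Γ.PL) :
    ∃ C, ∀ x, |f x| ≤ C := by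
  have he : ∀ e, ∃ C, ∀ t ∈ Icc 0 (Γ.len e), |f (Γ.point e t)| ≤ C := fun e => by
    simpa using isCompact_Icc.exists_bound_of_continuousOn (hf e).1
  choose C hC using he
  obtain ⟨A, hA⟩ := (Set.finite_range C).bddAbove
  obtain ⟨A', hA'⟩ := (Set.finite_range fun v => |f (.vertex v)|).bddAbove
  refine ⟨max A A', ?_⟩
  rintro (v | ⟨e, t, ht⟩)
  · exact (hA' (mem_range_self v)).trans (le_max_right _ _)
  · have := hC e t (Ioo_subset_Icc_self ht)
    rw [point, dif_pos ht] at this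
    exact this.trans ((hA (mem_range_self e)).trans (le_max_left _ _))

theorem tropComb_le {n : ℕ} (s : Fin (n + 1) → Γ.Point → ℝ) (a : Fin (n + 1) → ℝ)
    (x : Γ.Point) (i : Fin (n + 1)) : tropComb s a x ≤ s i x + a i :=
  Finset.inf'_le _ (Finset.mem_univ i)

theorem le_tropComb {n : ℕ} {s : Fin (n + 1) → Γ.Point → ℝ} {a : Fin (n + 1) → ℝ}
    {x : Γ.Point} {c : ℝ} (h : ∀ i, c ≤ s i x + a i) : c ≤ tropComb s a x :=
  Finset.le_inf' _ _ fun i _ => h i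

theorem exists_tropComb_eq {n : ℕ} (s : Fin (n + 1) → Γ.Point → ℝ) (a : Fin (n + 1) → ℝ)
    (x : Γ.Point) : ∃ i, tropComb s a x = s i x + a i := by
  obtain ⟨i, -, hi⟩ := Finset.exists_mem_eq_inf' Finset.univ_nonempty fun i => s i x + a i
  exact ⟨i, hi⟩

theorem abs_tropComb_sub_le {n : ℕ} (s : Fin (n + 1) → Γ.Point → ℝ) (a b : Fin (n + 1) → ℝ)
    (x : Γ.Point) : |tropComb s a x - tropComb s b x| ≤ dist a b := by
  have h (a b : Fin (n + 1) → ℝ) : tropComb s a x - tropComb s b x ≤ dist a b := by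
    obtain ⟨i, hi⟩ := exists_tropComb_eq s b x
    have h1 := tropComb_le s a x i
    have h2 := (le_abs_self _).trans (dist_le_pi_dist a b i)
    linarith
  exact abs_sub_le_iff.2 ⟨h a b, (h b a).trans_eq (dist_comm b a)⟩

theorem tropComb_sub_const {n : ℕ} (s : Fin (n + 1) → Γ.Point → ℝ) (a : Fin (n + 1) → ℝ) (k : ℝ)
    (x : Γ.Point) : tropComb s (fun i => a i - k) x = tropComb s a x - k := by
  obtain ⟨i, hi⟩ := exists_tropComb_eq s a x
  refine le_antisymm ?_ (le_tropComb fun j => ?_)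
  · linarith [tropComb_le s (fun i => a i - k) x i]
  · linarith [tropComb_le s a x j]

theorem bddAbove_sub {g s : Γ.Point → ℝ} {A C : ℝ} (hg : ∀ x, |g x| ≤ A) (hs : ∀ x, |s x| ≤ C) :
    BddAbove (range fun x => g x - s x) := by
  refine ⟨A + C, ?_⟩
  rintro _ ⟨x, rfl⟩
  have h1 := (abs_le.1 (hg x)).2
  have h2 := (abs_le.1 (hs x)).1
  simp only
  linarith

/-- A bounded uniform limit of tropical combinations of bounded functions is the tropical
combination with the least possible coefficients. -/
theorem eq_tropComb_iSup {n : ℕ} {s : Fin (n + 1) → Γ.Point → ℝ} {g : Γ.Point → ℝ} {A C : ℝ}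
    (hg : ∀ x, |g x| ≤ A) (hs : ∀ i x, |s i x| ≤ C)
    (h : ∀ ε > 0, ∃ g' ∈ tropSpan (range s), ∀ x, |g x - g' x| < ε) :
    g = tropComb s fun i => ⨆ x, (g x - s i x) := by
  funext x
  have : Nonempty Γ.Point := ⟨x⟩
  refine le_antisymm (le_tropComb fun i => ?_) (le_of_forall_pos_le_add fun ε hε => ?_)
  · linarith [le_ciSup (bddAbove_sub hg (hs i)) x]
  · obtain ⟨g', ⟨k, f, a, hf, rfl⟩, hgg'⟩ := h (ε / 2) (half_pos hε)
    obtain ⟨j, hj⟩ := exists_tropComb_eq f a x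
    obtain ⟨i, hi⟩ := hf j
    -- The index `i` attains the minimum `g'` at `x`, so `s i` plus its coefficient touches `g'`
    -- there and dominates it elsewhere; passing between `g'` and `g` twice costs `ε`.
    have hsup : ⨆ y, (g y - s i y) ≤ g x - s i x + ε := ciSup_le fun y => by
      have h1 := (abs_lt.1 (hgg' y)).2
      have h2 := (abs_lt.1 (hgg' x)).1
      have h3 := tropComb_le f a y j
      rw [← hi] at hj h3
      linarith
    linarith [tropComb_le s (fun i => ⨆ x, (g x - s i x)) x i]

theorem exists_uniform_bound [Finite V] [Finite E] {n : ℕ} {s : Fin n → Γ.Point → ℝ}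
    (hs : ∀ i, s i ∈ Γ.PL) : ∃ C, ∀ i x, |s i x| ≤ C := by
  choose C hC using fun i => exists_bound_of_mem_PL (hs i)
  obtain ⟨A, hA⟩ := (Set.finite_range C).bddAbove
  exact ⟨A, fun i x => (hC i x).trans (hA (mem_range_self i))⟩

/-- An enumeration of finitely many generators of a nonempty tropical submodule. -/
theorem IsFinitelyGenerated.exists_generators {L : Set (Γ.Point → ℝ)}
    (hL : IsFinitelyGenerated L) (hne : L.Nonempty) :
    ∃ (N : ℕ) (s : Fin (N + 1) → Γ.Point → ℝ), (∀ i, s i ∈ L) ∧ L = tropSpan (range s) := by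
  obtain ⟨S, hS, hSL, hLS⟩ := hL
  obtain ⟨g, hg⟩ := hne
  rw [hLS] at hg
  obtain ⟨n, f, a, hf, -⟩ := hg
  have : Finite S := hS
  obtain ⟨k, ⟨e⟩⟩ := Finite.exists_equiv_fin S
  obtain ⟨N, rfl⟩ : ∃ N, k = N + 1 :=
    Nat.exists_eq_succ_of_ne_zero fun h => by subst h; exact (e ⟨f 0, hf 0⟩).elim0
  have hr : range (fun i => (e.symm i : Γ.Point → ℝ)) = S := by
    ext x
    exact ⟨by rintro ⟨i, rfl⟩; exact (e.symm i).2, fun hx => ⟨e ⟨x, hx⟩, by simp⟩⟩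
  exact ⟨N, fun i => e.symm i, fun i => hSL (e.symm i).2, by rw [hr]; exact hLS⟩

theorem isUniformlyClosed_of_finitelyGenerated [Finite V] [Finite E] {L : Set (Γ.Point → ℝ)}
    (hPL : L ⊆ Γ.PL) (hsub : IsTropicalSubmodule L) (hL : IsFinitelyGenerated L) :
    IsUniformlyClosed L := by
  intro g hg hlim
  obtain ⟨g₀, hg₀, -⟩ := hlim 1 one_pos
  obtain ⟨N, s, hs, rfl⟩ := hL.exists_generators ⟨g₀, hg₀⟩
  obtain ⟨A, hA⟩ := exists_bound_of_mem_PL hg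
  obtain ⟨C, hC⟩ := exists_uniform_bound fun i => hPL (hs i)
  rw [eq_tropComb_iSup hA hC hlim]
  exact hsub _ _ _ hs

/-- The members of a finitely generated tropical submodule are, up to constants, tropical
combinations of the generators with coefficients in a fixed compact set. -/
theorem exists_bounded_coefficients [Finite V] [Finite E] {N : ℕ}
    {s : Fin (N + 1) → Γ.Point → ℝ} (hPL : tropSpan (range s) ⊆ Γ.PL)
    (hs : ∀ i, s i ∈ tropSpan (range s)) :
    ∃ M, ∀ g ∈ tropSpan (range s), ∃ c ∈ Metric.closedBall (0 : Fin (N + 1) → ℝ) M, ∃ k : ℝ,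
      ∀ x, tropComb s c x = g x - k := by
  obtain ⟨C, hC⟩ := exists_uniform_bound fun i => hPL (hs i)
  -- The absolute value keeps the radius nonnegative even when there are no points, where nothing
  -- forces `0 ≤ C`.
  refine ⟨|2 * C|, fun g hg => ?_⟩
  obtain ⟨A, hA⟩ := exists_bound_of_mem_PL (hPL hg)
  rcases isEmpty_or_nonempty Γ.Point with hE | hE
  · exact ⟨0, by simp, 0, fun x => hE.elim x⟩
  set c : Fin (N + 1) → ℝ := fun i => ⨆ x, (g x - s i x) with hc
  have hgc : g = tropComb s c :=
    eq_tropComb_iSup hA hC fun ε hε => ⟨g, hg, fun x => by simpa using hε⟩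
  have hle : ∀ i j, c i ≤ c j + 2 * C := fun i j => ciSup_le fun x => by
    have h1 := le_ciSup (bddAbove_sub hA (hC j)) x
    have h2 := (abs_le.1 (hC i x)).1
    have h3 := (abs_le.1 (hC j x)).2
    simp only [hc]
    linarith
  refine ⟨fun i => c i - c 0, ?_, c 0, fun x => ?_⟩
  · rw [mem_closedBall_zero_iff, pi_norm_le_iff_of_nonneg (abs_nonneg _)]
    intro i
    rw [Real.norm_eq_abs]
    refine (abs_le.2 ⟨?_, ?_⟩).trans (le_abs_self _) <;> linarith [hle i 0, hle 0 i]
  · rw [tropComb_sub_const, ← hgc]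

/-! ### Slopes of limits -/

/-- Close to the base of `ζ` the ray misses the support of `D`, so one length `t` serves all members
of `R(D)` at once; this uniformity is what permits a limit. -/
theorem eventually_affine_and_ord_nonneg [Finite E] {f : Γ.Point → ℝ} (hf : f ∈ Γ.PL)
    (D : Γ.Divisor) (ζ : Γ.Tangent) :
    ∀ᶠ t in 𝓝[>] (0 : ℝ), t ≤ ζ.room ∧ f (ζ.ray t) = f (ζ.ray 0) + outSlope f ζ * t ∧
      ∀ g ∈ completeSeries D, ∀ u ∈ Ioo 0 t, 0 ≤ ord g (ζ.ray u) := by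
  obtain ⟨m, hm, hev⟩ := eventually_outSlope hf ζ
  obtain ⟨δ, hδ, hsub⟩ := mem_nhdsGT_iff_exists_Ioo_subset.1
    (ζ.eventually_ray_notMem D.support.finite_toSet)
  filter_upwards [hev, self_mem_nhdsWithin, Ioo_mem_nhdsGT (mem_Ioi.1 hδ)] with t ht ht0 htδ
  refine ⟨ht.1, hm ▸ ht.2 t ⟨(mem_Ioi.1 ht0).le, le_rfl⟩, fun g hg u hu => ?_⟩
  have h1 : ζ.ray u ∉ (D.support : Set Γ.Point) := hsub ⟨hu.1, hu.2.trans htδ.2⟩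
  have h2 := hg.2 (ζ.ray u)
  rwa [Finsupp.notMem_support_iff.1 (by simpa using h1), Int.cast_zero, zero_add] at h2

/-- Slopes are upper semicontinuous when points of the divisor of zeros collide: if `g τ` has a
zero at distance `τ` along `η`, some limit `f` has smaller slopes than some `g τ`. -/
theorem exists_limit_outSlope_le [Finite V] [Finite E] {D : Γ.Divisor} {L : Set (Γ.Point → ℝ)}
    (hLD : L ⊆ completeSeries D) (hsub : IsTropicalSubmodule L) (hL : IsFinitelyGenerated L)
    {T : Set Γ.Tangent} (hT : T.Finite) {η : Γ.Tangent} (hη : η ∈ T) {δ : ℝ} (hδ : 0 < δ)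
    {g : ℝ → Γ.Point → ℝ} (hg : ∀ τ ∈ Ioo 0 δ, g τ ∈ L ∧ 1 ≤ ord (g τ) (η.ray τ)) :
    ∃ τ ∈ Ioo 0 δ, ∃ f ∈ L, (∀ ζ ∈ T, outSlope f ζ ≤ outSlope (g τ) ζ) ∧
      outSlope f η + 1 ≤ outSlope (g τ) η := by
  have hne : L.Nonempty := ⟨_, (hg (δ / 2) ⟨by linarith, by linarith⟩).1⟩
  obtain ⟨N, s, hs, rfl⟩ := hL.exists_generators hne
  have hPL : tropSpan (range s) ⊆ Γ.PL := fun f hf => (hLD hf).1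
  obtain ⟨M, hM⟩ := exists_bounded_coefficients hPL hs
  have hτ : ∀ n : ℕ, δ / (n + 2) ∈ Ioo 0 δ := fun n =>
    ⟨by positivity, div_lt_self hδ (by linarith [n.cast_nonneg (α := ℝ)])⟩
  choose c hcM k hck using fun n : ℕ => hM _ (hg _ (hτ n)).1
  obtain ⟨a, -, φ, hφ, ha⟩ := (isCompact_closedBall _ _).tendsto_subseq hcM
  have hf : tropComb s a ∈ tropSpan (range s) := hsub _ _ _ hs
  -- The length `t` depends on the limit, on `D` and on `T` only; the approximant is chosen
  -- afterwards.
  have hev := (hT.eventually_all (l := 𝓝[>] (0 : ℝ))).2 fun ζ _ =>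
    eventually_affine_and_ord_nonneg (hPL hf) D ζ
  obtain ⟨t, ht, ht0⟩ := (hev.and (self_mem_nhdsWithin : Ioi (0 : ℝ) ∈ _)).exists
  replace ht0 : 0 < t := ht0
  have hτ0 : Tendsto (fun n : ℕ => δ / ((φ n : ℝ) + 2)) atTop (𝓝 0) :=
    (tendsto_const_nhds.div_atTop
      (tendsto_atTop_add_const_right _ 2 tendsto_natCast_atTop_atTop)).comp hφ.tendsto_atTop
  -- Errors below `t / 4` at both ends of the segment shift the increment by less than `t / 2`, and
  -- `τ < t / 2` loses less than another `t / 2`. The total stays below `t`, as `hint` requires.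
  obtain ⟨n, hn1, hn2⟩ := ((hτ0.eventually_lt_const (half_pos ht0)).and
    (Metric.tendsto_nhds.1 ha (t / 4) (by linarith))).exists
  set τ := δ / ((φ n : ℝ) + 2) with hτdef
  have hgτ := hg τ (hτ (φ n))
  have hclose : ∀ x, |g τ x - k (φ n) - tropComb s a x| < t / 4 := fun x => by
    rw [← hck]
    exact (abs_tropComb_sub_le s _ _ x).trans_lt hn2
  have hint : ∀ (ζ : Γ.Tangent) (e : ℤ), (outSlope (tropComb s a) ζ - outSlope (g τ) ζ + e) * t < t →
      outSlope (tropComb s a) ζ + e ≤ outSlope (g τ) ζ := by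
    intro ζ e h
    obtain ⟨m₁, h₁, -⟩ := eventually_outSlope (hPL hf) ζ
    obtain ⟨m₂, h₂, -⟩ := eventually_outSlope (hPL hgτ.1) ζ
    rw [h₁, h₂] at h ⊢
    have : ((m₁ - m₂ + e : ℤ) : ℝ) < 1 := by
      push_cast
      exact (mul_lt_iff_lt_one_left ht0).1 h
    have : m₁ - m₂ + e < 1 := by exact_mod_cast this
    exact_mod_cast (by lia : m₁ + e ≤ m₂)
  refine ⟨τ, hτ (φ n), _, hf, fun ζ hζ => ?_, ?_⟩
  · obtain ⟨h1, h2, h3⟩ := ht ζ hζ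
    have h4 := ray_le_tangent (hPL hgτ.1) ht0 h1 (h3 _ (hLD hgτ.1))
    have h5 := abs_lt.1 (hclose (ζ.ray t))
    have h6 := abs_lt.1 (hclose (ζ.ray 0))
    simpa using hint ζ 0 (by push_cast; linarith [h5.1, h6.2])
  · obtain ⟨h1, h2, h3⟩ := ht η hη
    have h4 := ray_le_tangent_of_one_le_ord (hPL hgτ.1) (hτ (φ n)).1 (hn1.trans (by linarith)) h1
      (h3 _ (hLD hgτ.1)) hgτ.2
    have h5 := abs_lt.1 (hclose (η.ray t))
    have h6 := abs_lt.1 (hclose (η.ray 0))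
    simpa using hint η 1 (by push_cast; linarith [h5.1, h6.2])

end MetricGraph

/-! ### Ranks of principal subarrays -/

namespace DotArray

variable {d r : ℕ} {P : DotArray d r}

/-- A meet of finitely many positions is taken coordinatewise, and in a linear order each coordinate
minimum is attained. -/
theorem exists_mem_eq_of_mem_redundantClosure {x : Fin d → Fin (r + 1)}
    (hx : x ∈ P.redundantClosure) (i : Fin d) : ∃ y ∈ P, x ≤ y ∧ y i = x i := by
  rcases hx with hx | ⟨H, hHP, hcard, hglb, -⟩
  · exact ⟨x, hx, le_rfl, rfl⟩
  · have hne : (H.image fun y => y i).Nonempty :=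
      (Finset.card_pos.1 (by omega : 0 < H.card)).image _
    have h1 : IsGLB ((fun y : Fin d → Fin (r + 1) => y i) '' (H : Set _)) (x i) :=
      isGLB_pi.1 hglb i
    have h2 := (Finset.isLeast_min' _ hne).isGLB
    rw [Finset.coe_image] at h2
    obtain ⟨y, hyH, hy⟩ := Finset.mem_image.1 (Finset.min'_mem _ hne)
    exact ⟨y, hHP hyH, hglb.1 hyH, hy.trans (h2.unique h1)⟩

theorem HasRank.ncard_le {x : Fin d → Fin (r + 1)} {ρ : ℤ} (h : (P.principal x).HasRank ρ)
    {i : Fin d} {A : Set (Fin (r + 1))} (hA : A ⊆ (fun y : Fin d → Fin (r + 1) => y i) ''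
      P.principal x) : (A.ncard : ℤ) ≤ ρ + 1 := by
  have h1 := h i
  have h2 : A.ncard ≤ _ := Set.ncard_le_ncard hA (Set.toFinite _)
  unfold axisRank at h1
  omega

/-- Dimension zero is excluded because there every integer is vacuously a rank. -/
theorem HasRank.nonneg [NeZero d] {x : Fin d → Fin (r + 1)} {ρ : ℤ}
    (h : (P.principal x).HasRank ρ) (hx : x ∈ P.redundantClosure) : 0 ≤ ρ := by
  obtain ⟨y, hy, hxy, -⟩ := exists_mem_eq_of_mem_redundantClosure hx 0
  have := h.ncard_le (i := 0) (A := {y 0}) (by simpa using ⟨y, ⟨hy, hxy⟩, rfl⟩)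
  rw [Set.ncard_singleton] at this
  push_cast at this
  linarith

theorem HasRank.mono [NeZero d] {x y : Fin d → Fin (r + 1)} {ρ σ : ℤ}
    (hx : (P.principal x).HasRank ρ) (hy : (P.principal y).HasRank σ) (hxy : x ≤ y) : σ ≤ ρ := by
  have h1 := hx.ncard_le (i := 0) (A := (fun z : Fin d → Fin (r + 1) => z 0) '' P.principal y)
    (Set.image_mono fun z hz => ⟨hz.1, hxy.trans hz.2⟩)
  have h2 := hy 0
  unfold axisRank at h2
  linarith

/-- The value `x i` occurs on `P[x]` because `x` is in the redundant closure, but not on `P[y]`,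
where all `i`-th coordinates are at least `y i`. -/
theorem HasRank.lt {x y : Fin d → Fin (r + 1)} {ρ σ : ℤ}
    (hx : (P.principal x).HasRank ρ) (hy : (P.principal y).HasRank σ) (hxy : x ≤ y)
    (hxP : x ∈ P.redundantClosure) {i : Fin d} (hi : x i < y i) : σ + 1 ≤ ρ := by
  obtain ⟨z, hz, hxz, hzi⟩ := exists_mem_eq_of_mem_redundantClosure hxP i
  set A := (fun z : Fin d → Fin (r + 1) => z i) '' P.principal y with hA
  have hnot : x i ∉ A := by
    rintro ⟨w, hw, hwi⟩
    exact (hw.2 i).not_gt (hwi.trans_lt hi)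
  have h1 := hx.ncard_le (i := i) (A := insert (x i) A) (Set.insert_subset
    ⟨z, ⟨hz, hxz⟩, hzi⟩ (Set.image_mono fun w hw => ⟨hw.1, hxy.trans hw.2⟩))
  rw [Set.ncard_insert_of_notMem hnot (Set.toFinite _)] at h1
  have h2 := hy i
  unfold axisRank at h2
  push_cast at h1
  linarith

/-- In the redundant closure of the standard array of dimension two, a position of rank zero is
dotted. -/
theorem HasRank.one_le_or_eq_rev {x : Fin d → Fin (r + 1)} {ρ : ℤ}
    (h : ((standard d r).principal x).HasRank ρ) (hx : x ∈ (standard d r).redundantClosure)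
    {i j : Fin d} (hij : i ≠ j) (huniv : Finset.univ = {i, j}) : 1 ≤ ρ ∨ x j = (x i).rev := by
  obtain ⟨y, hy, hxy, hyi⟩ := exists_mem_eq_of_mem_redundantClosure hx i
  obtain ⟨z, hz, hxz, hzj⟩ := exists_mem_eq_of_mem_redundantClosure hx j
  have hy' : ((y i : ℕ) + y j = r) := by
    have : ∑ k, (y k : ℕ) = r := hy
    rwa [huniv, Finset.sum_pair hij] at this
  have hz' : ((z i : ℕ) + z j = r) := by
    have : ∑ k, (z k : ℕ) = r := hz
    rwa [huniv, Finset.sum_pair hij] at this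
  -- If the dotted positions sharing a coordinate with `x` agree, they pin `x` to the antidiagonal;
  -- otherwise they supply two values of the `i`-th coordinate.
  by_cases hyz : y i = z i
  · right
    apply Fin.ext
    rw [Fin.val_rev, ← hzj, ← hyi, hyz]
    omega
  · left
    have h1 := h.ncard_le (i := i) (A := {y i, z i}) (by
      rintro _ (rfl | rfl)
      · exact ⟨y, ⟨hy, hxy⟩, rfl⟩
      · exact ⟨z, ⟨hz, hxz⟩, rfl⟩)
    rw [Set.ncard_pair hyz] at h1
    push_cast at h1
    linarith

end DotArray

/-! ### Local ranks and the return of zeros to special points -/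

namespace MetricGraph

variable {V E : Type*} {Γ : MetricGraph V E}

theorem finite_setOf_base_mem [Finite E] {K : Set Γ.Point} (hK : K.Finite) :
    {ζ : Γ.Tangent | ζ.base ∈ K}.Finite := by
  refine (hK.biUnion fun v _ => Set.finite_range fun ζ : Γ.TangentAt v => ζ.1).subset ?_
  intro ζ hζ
  exact Set.mem_biUnion hζ ⟨⟨ζ, rfl⟩, rfl⟩

theorem Divisor.degree_add (D F : Γ.Divisor) : (D + F).degree = D.degree + F.degree :=
  Finsupp.sum_add_index' (fun _ => rfl) fun _ _ _ => rfl

theorem Divisor.degree_single (v : Γ.Point) (n : ℤ) :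
    Divisor.degree (Finsupp.single v n : Γ.Divisor) = n :=
  Finsupp.sum_single_index rfl

namespace SlopeStructure

variable [Finite E] {r : ℕ} (𝔖 : Γ.SlopeStructure r)

theorem ord_eq_of_isIndex {f : Γ.Point → ℝ} {v : Γ.Point} {x : Fin (Γ.val v) → Fin (r + 1)}
    (hx : 𝔖.IsIndex f v x) : ord f v = -∑ k, (𝔖.s (𝔖.order v k).1 (x k) : ℝ) := by
  unfold ord
  rw [← (𝔖.order v).sum_comp]
  exact congrArg _ (Finset.sum_congr rfl fun k _ => hx k)

theorem index_le {f g : Γ.Point → ℝ} {v : Γ.Point} {x y : Fin (Γ.val v) → Fin (r + 1)}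
    (hx : 𝔖.IsIndex f v x) (hy : 𝔖.IsIndex g v y)
    (h : ∀ ζ : Γ.TangentAt v, outSlope f ζ.1 ≤ outSlope g ζ.1) : x ≤ y := fun k => by
  have := h (𝔖.order v k)
  rw [hx k, hy k] at this
  exact (𝔖.s_strictMono _).le_iff_le.1 (by exact_mod_cast this)

/-- At a point outside of `W`, a function with a zero has positive local rank. -/
theorem one_le_rank_of_ord_pos {f : Γ.Point → ℝ} {v : Γ.Point} (hv : v ∉ 𝔖.W)
    {x : Fin (Γ.val v) → Fin (r + 1)} (hx : 𝔖.IsIndex f v x)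
    (hxP : x ∈ (𝔖.P v).redundantClosure) {ρ : ℤ} (hρ : ((𝔖.P v).principal x).HasRank ρ)
    (hord : 0 < ord f v) : 1 ≤ ρ := by
  have hval : Γ.val v = 2 := by
    by_contra h
    exact hv (𝔖.mem_W v h)
  obtain ⟨i, j, hij, huniv⟩ : ∃ i j : Fin (Γ.val v), i ≠ j ∧ Finset.univ = {i, j} := by
    rw [hval]
    exact ⟨0, 1, by decide, by decide⟩
  rw [𝔖.P_standard v hv] at hρ hxP
  -- In the other alternative the two slopes are opposite, so the order would vanish.
  refine (hρ.one_le_or_eq_rev hxP hij huniv).resolve_right fun hrev => ?_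
  have hopp := 𝔖.s_opposite _ _ (.through (𝔖.order v i).1 (𝔖.order v j).1
    ((𝔖.order v i).2.trans (𝔖.order v j).2.symm)
    (fun h => hij ((𝔖.order v).injective (Subtype.ext h)))
    (by rw [(𝔖.order v i).2]; exact hv)) (x i)
  rw [𝔖.ord_eq_of_isIndex hx, huniv, Finset.sum_pair hij, hrev] at hord
  have : ((𝔖.s (𝔖.order v i).1 (x i) : ℤ) : ℝ) + 𝔖.s (𝔖.order v j).1 (x i).rev = 0 := by
    exact_mod_cast hopp
  linarith

/-- At valence zero any integer is a rank, so a bound is needed only at positive valence. -/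
theorem exists_rank_ge (v : Γ.Point) (x : Fin (Γ.val v) → Fin (r + 1)) {n : ℤ}
    (h : Γ.val v ≠ 0 → ∀ ρ, ((𝔖.P v).principal x).HasRank ρ → n ≤ ρ) :
    ∃ ρ : ℤ, ((𝔖.P v).principal x).HasRank ρ ∧ n ≤ ρ := by
  by_cases hv : Γ.val v = 0
  · exact ⟨n, fun i => absurd i.2 (by omega), le_rfl⟩
  · obtain ⟨ρ, hρ⟩ := (𝔖.P_perm v).totallyRankable x
    exact ⟨ρ, hρ, h hv ρ hρ⟩

end SlopeStructure

variable [Finite V] [Finite E] {r : ℕ} {D : Γ.Divisor} {L : Set (Γ.Point → ℝ)}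

/-- If a zero of multiplicity one can be prescribed at all nearby points along `η`, in addition to
`F`, then one more zero can be prescribed at the base of `η`. -/
theorem exists_rank_property_add_single (hL : IsTropicalLinearSeries r D L)
    (𝔖 : Γ.SlopeStructure r) (hS : L ⊆ 𝔖.series) {F : Γ.Divisor} (η : Γ.Tangent)
    {K : Set Γ.Point} (hK : K.Finite) (hη : η.base ∈ K) (hFK : ∀ p ∉ K, F p = 0)
    (hDK : ∀ p ∉ K, D p = 0)
    (h : ∀ w ∉ K, ∃ f ∈ L, BNRP D (F + Finsupp.single w 1) f ∧ 𝔖.LRP (F + Finsupp.single w 1) f) :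
    ∃ f ∈ L, BNRP D (F + Finsupp.single η.base 1) f ∧
      𝔖.LRP (F + Finsupp.single η.base 1) f := by
  classical
  obtain ⟨δ, hδ, hsub⟩ := mem_nhdsGT_iff_exists_Ioo_subset.1 (η.eventually_ray_notMem hK)
  -- The zero function is a dummy value outside `(0, δ)`, making the family total in `τ`.
  have h' : ∀ τ : ℝ, ∃ f, τ ∈ Ioo 0 δ → f ∈ L ∧ BNRP D (F + Finsupp.single (η.ray τ) 1) f ∧
      𝔖.LRP (F + Finsupp.single (η.ray τ) 1) f := fun τ => by
    by_cases hτ : τ ∈ Ioo 0 δ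
    · obtain ⟨f, hf⟩ := h _ (hsub hτ)
      exact ⟨f, fun _ => hf⟩
    · exact ⟨0, fun h => absurd h hτ⟩
  choose g hg using h'
  obtain ⟨τ, hτ, f, hfL, hle, hlt⟩ := exists_limit_outSlope_le hL.subset hL.submodule
    hL.finitelyGenerated (finite_setOf_base_mem hK) hη (mem_Ioi.1 hδ) (g := g) fun τ hτ => by
      refine ⟨(hg τ hτ).1, ?_⟩
      have := (hg τ hτ).2.1 (η.ray τ)
      simpa [hDK _ (hsub hτ), hFK _ (hsub hτ)] using this
  obtain ⟨hgL, hgB, hgR⟩ := hg τ hτ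
  have hle' : ∀ p ∈ K, ∀ ζ : Γ.TangentAt p, outSlope f ζ.1 ≤ outSlope (g τ) ζ.1 :=
    fun p hp ζ => hle ζ.1 (by simpa [ζ.2] using hp)
  have hw : ∀ p ∈ K, (F + Finsupp.single (η.ray τ) 1 : Γ.Divisor) p = F p := fun p hp => by
    rw [Finsupp.add_apply, Finsupp.single_eq_of_ne, add_zero]
    rintro rfl
    exact hsub hτ hp
  have hoff : ∀ p ∉ K, (F + Finsupp.single η.base 1 : Γ.Divisor) p = 0 := fun p hp => by
    rw [Finsupp.add_apply, hFK p hp, Finsupp.single_eq_of_ne, add_zero]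
    rintro rfl
    exact hp hη
  refine ⟨f, hfL, fun p => ?_, fun p => ?_⟩
  · by_cases hp : p ∈ K
    · have h1 := hgB p
      rw [hw p hp] at h1
      by_cases hpη : p = η.base
      · subst hpη
        have hsum : ∑ ζ : Γ.TangentAt η.base, outSlope f ζ.1 + 1 ≤
            ∑ ζ : Γ.TangentAt η.base, outSlope (g τ) ζ.1 := by
          rw [← Finset.add_sum_erase _ _ (Finset.mem_univ (⟨η, rfl⟩ : Γ.TangentAt η.base)),
            ← Finset.add_sum_erase _ (fun ζ : Γ.TangentAt η.base => outSlope (g τ) ζ.1)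
              (Finset.mem_univ (⟨η, rfl⟩ : Γ.TangentAt η.base))]
          have := Finset.sum_le_sum fun ζ
            (_ : ζ ∈ Finset.univ.erase (⟨η, rfl⟩ : Γ.TangentAt η.base)) => hle' _ hp ζ
          linarith
        rw [Finsupp.add_apply, Finsupp.single_eq_same]
        push_cast
        unfold ord at h1 ⊢
        linarith
      · rw [Finsupp.add_apply, Finsupp.single_eq_of_ne hpη, add_zero]
        have := Finset.sum_le_sum fun ζ (_ : ζ ∈ Finset.univ) => hle' p hp ζ
        unfold ord at h1 ⊢
        linarith
    · rw [hoff p hp, Int.cast_zero, add_comm]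
      exact (hL.subset hfL).2 p
  · obtain ⟨x, hx, hxP⟩ := (hS hfL).2 p
    refine ⟨x, hx, 𝔖.exists_rank_ge p x fun hval ρ hρ => ?_⟩
    have : NeZero (Γ.val p) := ⟨hval⟩
    by_cases hp : p ∈ K
    · obtain ⟨y, hy, σ, hσ, hFσ⟩ := hgR p
      rw [hw p hp] at hFσ
      have hxy := 𝔖.index_le hx hy (hle' p hp)
      by_cases hpη : p = η.base
      · subst hpη
        rw [Finsupp.add_apply, Finsupp.single_eq_same]
        let i := (𝔖.order η.base).symm ⟨η, rfl⟩
        have hi : x i < y i := by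
          have h1 := hx i
          have h2 := hy i
          simp only [i, Equiv.apply_symm_apply] at h1 h2
          rw [h1, h2] at hlt
          refine (𝔖.s_strictMono η).lt_iff_lt.1 ?_
          have : 𝔖.s η (x i) + 1 ≤ 𝔖.s η (y i) := by exact_mod_cast hlt
          linarith
        linarith [hρ.lt hσ hxy hxP hi]
      · rw [Finsupp.add_apply, Finsupp.single_eq_of_ne hpη, add_zero]
        exact hFσ.trans (hρ.mono hσ hxy)
    · rw [hoff p hp]
      exact hρ.nonneg hxP

/-- Induction on the number `n` of prescribed zeros at points of `Z` of positive valence. Points of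
valence zero are not counted: no zero can leave them, and the rank condition there is vacuous. -/
theorem exists_local_rank_property (hL : IsTropicalLinearSeries r D L)
    (𝔖 : Γ.SlopeStructure r) (hS : L ⊆ 𝔖.series) (Z : Finset Γ.Point) (hWZ : 𝔖.W ⊆ Z)
    (hDZ : D.support ⊆ Z) (n : ℕ) (F : Γ.Divisor) (hF : 0 ≤ F) (hdeg : F.degree = r)
    (hoff : ∀ p ∉ Z, F p ≤ 1) (hn : ∑ p ∈ Z with Γ.val p ≠ 0, F p = n) :
    ∃ f ∈ L, BNRP D F f ∧ 𝔖.LRP F f := by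
  classical
  induction n generalizing F with
  | zero =>
    have hzero := (Finset.sum_eq_zero_iff_of_nonneg fun p _ => hF p).1 hn
    obtain ⟨f, hfL, hfB⟩ := hL.rank F hF hdeg
    refine ⟨f, hfL, hfB, fun p => ?_⟩
    obtain ⟨x, hx, hxP⟩ := (hS hfL).2 p
    refine ⟨x, hx, 𝔖.exists_rank_ge p x fun hval ρ hρ => ?_⟩
    have : NeZero (Γ.val p) := ⟨hval⟩
    have hρ0 := hρ.nonneg hxP
    by_cases hp : p ∈ Z
    · rwa [hzero p (Finset.mem_filter.2 ⟨hp, hval⟩)]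
    · rcases (hF p).eq_or_lt with h0 | h0
      · rwa [← h0]
      · refine (hoff p hp).trans (𝔖.one_le_rank_of_ord_pos (fun h => hp (hWZ h)) hx hxP hρ ?_)
        have h1 := hfB p
        rw [Finsupp.notMem_support_iff.1 fun h => hp (hDZ h), Int.cast_zero, add_zero] at h1
        exact (Int.cast_pos.2 h0).trans_le h1
  | succ n ih =>
    obtain ⟨v, hv, hFv⟩ : ∃ v ∈ Z.filter (Γ.val · ≠ 0), 0 < F v := by
      by_contra! h
      have := Finset.sum_nonpos h
      push_cast at hn
      linarith
    obtain ⟨hvZ, hval⟩ := Finset.mem_filter.1 hv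
    obtain ⟨⟨η, rfl⟩⟩ : Nonempty (Γ.TangentAt v) := Fintype.card_pos_iff.1 (Nat.pos_of_ne_zero hval)
    set G := F - Finsupp.single η.base 1 with hG
    have hFG : F = G + Finsupp.single η.base 1 := (sub_add_cancel _ _).symm
    have hG0 : 0 ≤ G := fun p => by
      by_cases hp : p = η.base
      · subst hp
        simp [hG]
        linarith
      · simpa [hG, Finsupp.single_eq_of_ne hp] using hF p
    have hGle : ∀ p, G p ≤ F p := fun p => by
      rw [hFG, Finsupp.add_apply]
      have : (0 : Γ.Divisor) ≤ Finsupp.single η.base 1 := Finsupp.single_nonneg.2 zero_le_one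
      linarith [this p, Finsupp.zero_apply (M := ℤ) (a := p)]
    -- Avoiding `F.support` as well makes the pushed zero land on an unoccupied point, so
    -- multiplicities outside `Z` stay at most one.
    have hK : ((Z ∪ F.support : Finset Γ.Point) : Set Γ.Point).Finite := Finset.finite_toSet _
    rw [hFG]
    refine exists_rank_property_add_single hL 𝔖 hS η hK (by simp [hvZ]) (fun p hp => ?_)
      (fun p hp => ?_) fun w hw => ?_
    · have h1 : F p = 0 := by
        by_contra h
        exact hp (by simp [h])
      exact le_antisymm ((hGle p).trans h1.le) (hG0 p)
    · by_contra h
      exact hp (by simp [hDZ (Finsupp.mem_support_iff.2 h)])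
    · rw [Finset.mem_coe, Finset.mem_union, not_or, Finsupp.notMem_support_iff] at hw
      have hsingle : (0 : Γ.Divisor) ≤ Finsupp.single w 1 := Finsupp.single_nonneg.2 zero_le_one
      refine ih _ (add_nonneg hG0 hsingle) ?_ (fun p hp => ?_) ?_
      · rw [Divisor.degree_add, Divisor.degree_single, ← hdeg, hFG, Divisor.degree_add,
          Divisor.degree_single]
      · rw [Finsupp.add_apply]
        by_cases hpw : p = w
        · subst hpw
          rw [Finsupp.single_eq_same]
          linarith [hGle p]
        · rw [Finsupp.single_eq_of_ne hpw, add_zero]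
          exact (hGle p).trans (hoff p hp)
      · have h1 : ∑ p ∈ Z with Γ.val p ≠ 0, (Finsupp.single w 1 : Γ.Divisor) p = 0 :=
          Finset.sum_eq_zero fun p hp => Finsupp.single_eq_of_ne fun h =>
            hw.1 (h ▸ (Finset.mem_filter.1 hp).1)
        have h2 : ∑ p ∈ Z with Γ.val p ≠ 0, (Finsupp.single η.base 1 : Γ.Divisor) p = 1 := by
          rw [Finset.sum_eq_single_of_mem _ hv fun p _ hp => Finsupp.single_eq_of_ne hp,
            Finsupp.single_eq_same]
        rw [hFG] at hn
        simp only [Finsupp.add_apply, Finset.sum_add_distrib, h1, h2] at hn ⊢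
        push_cast at hn
        linarith

end MetricGraph

end

/-! ### The equivalence -/

theorem mainTheorem4 {V E : Type*} [Finite V] [Finite E] (Γ : MetricGraph V E) (r : ℕ)
    (D : Γ.Divisor) (L : Set (Γ.Point → ℝ)) (hL : MetricGraph.IsTropicalLinearSeries r D L) :
    MetricGraph.IsStructured r L ↔ MetricGraph.IsCombinatorialLimitLinearSeries r D L := by
  classical
  constructor
  · rintro ⟨𝔖, hS⟩
    refine ⟨⟨hL.subset, hL.submodule, MetricGraph.isUniformlyClosed_of_finitelyGenerated
      (fun f hf => (hL.subset hf).1) hL.submodule hL.finitelyGenerated, 𝔖,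
      Set.subset_inter hL.subset hS, fun F hF hdeg => ?_⟩, hL.finitelyGenerated, hL.dependent⟩
    -- With the support of `F` included, `F` vanishes outside `Z` at the start; zeros appear there
    -- only as they are pushed away.
    let Z := 𝔖.W ∪ D.support ∪ F.support
    refine MetricGraph.exists_local_rank_property hL 𝔖 hS Z
      (Finset.subset_union_left.trans Finset.subset_union_left)
      (Finset.subset_union_right.trans Finset.subset_union_left)
      (∑ p ∈ Z with Γ.val p ≠ 0, F p).toNat F hF hdeg (fun p hp => ?_)
      (Int.toNat_of_nonneg (Finset.sum_nonneg fun p _ => hF p)).symm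
    rw [Finsupp.notMem_support_iff.1 fun h => hp (Finset.mem_union_right _ h)]
    exact zero_le_one
  · rintro ⟨⟨-, -, -, 𝔖, hS, -⟩, -, -⟩
    exact ⟨𝔖, fun f hf => (hS hf).2⟩
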